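/- **Setting.** A context $x$ is drawn from a probability measure $\nu$ on a measurable space $\mathcal X$, the actions are $\mathcal A=\{1,\dots,K\}$, and given $(x,a)$ the cost $c\in[-1,0]$ is drawn from a distribution $p(\cdot\mid x,a)$. For a policy $\pi$ (a probability kernel from $\mathcal X$ to $\mathcal A$) let $\mu_\pi$ be the law of $(x,a,c)$ with $x\sim\nu$, $a\sim\pi(\cdot\mid x)$, $c\sim p(\cdot\mid x,a)$, and let $R(\pi)=\mathbb E_{(x,a,c)\sim\mu_\pi}[c]$ be its risk. The logged data $\mathcal D_n=(x_i,a_i,c_i)_{i\le n}$ are i.i.d. from $\mu_{\pi_0}$, where $\pi_0$ is the logging policy. Let $\mathcal H$ be a measurable space of hypotheses $h:\mathcal X\to\mathcal A$ such that $(h,x)\mapsto h(x)$ is measurable, and let $\mathcal M_1(\mathcal H)$ be the set of probability measures on $\mathcal H$. For $\mathbb Q\in\mathcal M_1(\mathcal H)$ put $\pi_{\mathbb Q}(a\mid x)=\mathbb Q(h(x)=a)$. Let $\lambda>0$, $n\ge1$, $\delta\in(0,1]$, $\alpha\in[0,1]$, and fix a prior $\mathbb P\in\mathcal M_1(\mathcal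 H)$. If $\alpha=1$, assume moreover that for $\nu$-almost every $x$ and all $a$, $\pi_0(a\mid x)=0$ implies $\pi_{\mathbb P}(a\mid x)=0$. Define $$\hat R_n^\alpha(\pi)=\frac1n\sum_{i=1}^n c_i\,\frac{\pi(a_i\mid x_i)}{\pi_0(a_i\mid x_i)^\alpha},\qquad B_n^\alpha(\pi)=1-\frac1n\sum_{i=1}^n\mathbb E_{a\sim\pi(\cdot\mid x_i)}\big[\pi_0(a\mid x_i)^{1-\alpha}\big],$$ $$\bar V_n^\alpha(\pi)=\frac1n\sum_{i=1}^n\left(\mathbb E_{a\sim\pi_0(\cdot\mid x_i)}\left[\frac{\pi(a\mid x_i)}{\pi_0(a\mid x_i)^{2\alpha}}\right]+\frac{\pi(a_i\mid x_i)\,c_i^2}{\pi_0(a_i\mid x_i)^{2\alpha}}\right),$$ $$\mathrm{kl}_1(\mathbb Q)=D_{\mathrm{KL}}(\mathbb Q\,\|\,\mathbb P)+\log\frac{4\sqrt n}{\delta},\qquad \mathrm{kl}_2(\mathbb Q)=D_{\mathrm{KL}}(\mathbb Q\,\|\,\mathbb P)+\log\frac4\delta .$$ **Proposition.** With probability at least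 $1-\delta$ over $\mathcal D_n\sim\mu_{\pi_0}^n$, the following holds. For every minimizer $\hat{\mathbb Q}_n$ over $\mathcal M_1(\mathcal H)$ of $$\mathbb Q\mapsto\hat R_n^\alpha(\pi_{\mathbb Q})+\sqrt{\frac{\mathrm{kl}_1(\mathbb Q)}{2n}}+B_n^\alpha(\pi_{\mathbb Q})+\frac{\mathrm{kl}_2(\mathbb Q)}{n\lambda}+\frac\lambda2\bar V_n^\alpha(\pi_{\mathbb Q})$$ and every minimizer $\mathbb Q_*$ over $\mathcal M_1(\mathcal H)$ of $\mathbb Q\mapsto R(\pi_{\mathbb Q})$, $$R(\pi_{\hat{\mathbb Q}_n})\le R(\pi_{\mathbb Q_*})+2\sqrt{\frac{\mathrm{kl}_1(\mathbb Q_*)}{2n}}+2B_n^\alpha(\pi_{\mathbb Q_*})+\frac{2\,\mathrm{kl}_2(\mathbb Q_*)}{n\lambda}+\lambda\bar V_n^\alpha(\pi_{\mathbb Q_*}),$$ where the right-hand side is $+\infty$ if $D_{\mathrm{KL}}(\mathbb Q_*\,\|\,\mathbb P)=\infty$. -/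

import Mathlib

open MeasureTheory ProbabilityTheory InformationTheory
open scoped ENNReal

namespace OffPolicy

section Bandit

variable {X : Type*} [MeasurableSpace X] {K : ℕ}

/-- One logged interaction: context, action in `[K]`, cost. -/
abbrev Sample (X : Type*) (K : ℕ) : Type _ := (X × Fin K) × ℝ

/-- The joint law `μ_π(x, a, c) = ν(x) π(a | x) p(c | x, a)` of (context, action, cost) when
actions are drawn by the policy `π`. -/
noncomputable def jointLaw (ν : Measure X) (p : Kernel (X × Fin K) ℝ) (π : Kernel X (Fin K)) :
    Measure (Sample X K) :=
  (ν.compProd π).compProd p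

/-- The risk `R(π) = E_{(x, a, c) ∼ μ_π}[c]`. -/
noncomputable def risk (ν : Measure X) (p : Kernel (X × Fin K) ℝ) (π : Kernel X (Fin K)) : ℝ :=
  ∫ z, z.2 ∂(jointLaw ν p π)

/-- The probability `π(a | x)` of action `a` in context `x`. -/
noncomputable def prob (π : Kernel X (Fin K)) (a : Fin K) (x : X) : ℝ := (π x).real {a}

/-- The exponentially smoothed estimator
`R̂_n^α(π) = (1/n) ∑ᵢ cᵢ π(aᵢ | xᵢ) / π₀(aᵢ | xᵢ)^α`. -/
noncomputable def estRisk (α : ℝ) (π₀ π : Kernel X (Fin K)) {n : ℕ} (D : Fin n → Sample X K) :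
    ℝ :=
  (1 / (n : ℝ)) * ∑ i, (D i).2 * (prob π (D i).1.2 (D i).1.1 / prob π₀ (D i).1.2 (D i).1.1 ^ α)

/-- `B_n^α(π) = 1 - (1/n) ∑ᵢ E_{a ∼ π(· | xᵢ)}[π₀(a | xᵢ)^(1-α)]`. -/
noncomputable def bias (α : ℝ) (π₀ π : Kernel X (Fin K)) {n : ℕ} (D : Fin n → Sample X K) : ℝ :=
  1 - (1 / (n : ℝ)) * ∑ i, ∫ a, prob π₀ a (D i).1.1 ^ (1 - α) ∂(π (D i).1.1)

/-- `V̄_n^α(π) = (1/n) ∑ᵢ (E_{a ∼ π₀(· | xᵢ)}[π(a | xᵢ) / π₀(a | xᵢ)^(2α)]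
  + π(aᵢ | xᵢ) cᵢ² / π₀(aᵢ | xᵢ)^(2α))`. -/
noncomputable def secondMoment (α : ℝ) (π₀ π : Kernel X (Fin K)) {n : ℕ}
    (D : Fin n → Sample X K) : ℝ :=
  (1 / (n : ℝ)) * ∑ i,
    ((∫ a, prob π a (D i).1.1 / prob π₀ a (D i).1.1 ^ (2 * α) ∂(π₀ (D i).1.1))
      + prob π (D i).1.2 (D i).1.1 * (D i).2 ^ 2 / prob π₀ (D i).1.2 (D i).1.1 ^ (2 * α))

end Bandit

section Posterior

variable {X : Type*} [MeasurableSpace X] {K : ℕ} {H : Type*} [MeasurableSpace H]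

/-- The policy `π_Q` induced by a distribution `Q` on a hypothesis space `H` whose elements act
as maps `ev h : X → [K]`: the action in context `x` is `h(x)` with `h ∼ Q`. -/
noncomputable def policy (ev : H → X → Fin K) (hev : Measurable (Function.uncurry ev))
    (Q : ProbabilityMeasure H) : Kernel X (Fin K) where
  toFun x := (Q : Measure H).map (fun h => ev h x)
  measurable' := by
    refine Measure.measurable_of_measurable_coe _ fun s hs => ?_
    have hm : ∀ x, Measurable fun h => ev h x := fun x =>
      hev.comp (measurable_id.prodMk measurable_const)
    have heq : (fun x => (Q : Measure H).map (fun h => ev h x) s)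
        = fun x => (Q : Measure H) ((fun h => (h, x)) ⁻¹' (Function.uncurry ev ⁻¹' s)) := by
      funext x
      rw [Measure.map_apply (hm x) hs]
      rfl
    rw [heq]
    exact measurable_measure_prodMk_right (hev hs)

/-- `π_Q(a | x) = E_{h ∼ Q}[1{h(x) = a}]`. -/
theorem prob_policy (ev : H → X → Fin K) (hev : Measurable (Function.uncurry ev))
    (Q : ProbabilityMeasure H) (a : Fin K) (x : X) :
    prob (policy ev hev Q) a x = ∫ h, (if ev h x = a then (1 : ℝ) else 0) ∂(Q : Measure H) := by
  have hm : Measurable fun h => ev h x := hev.comp (measurable_id.prodMk measurable_const)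
  have h1 : (fun h => if ev h x = a then (1 : ℝ) else 0)
      = ((fun h => ev h x) ⁻¹' {a}).indicator 1 := by
    funext h
    by_cases hx : ev h x = a
    · rw [Set.indicator_of_mem (show h ∈ (fun h => ev h x) ⁻¹' {a} from hx), if_pos hx]
      rfl
    · rw [Set.indicator_of_notMem (show h ∉ (fun h => ev h x) ⁻¹' {a} from hx), if_neg hx]
  rw [h1, integral_indicator_one (hm (measurableSet_singleton a))]
  change ((Q : Measure H).map (fun h => ev h x)).real {a} = _
  rw [measureReal_def, measureReal_def, Measure.map_apply hm (measurableSet_singleton a)]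

/-- `kl₁ = D_KL(Q ‖ P) + log (4 √n / δ)`, possibly infinite. -/
noncomputable def kl₁ (n : ℕ) (δ : ℝ) (P Q : ProbabilityMeasure H) : ℝ≥0∞ :=
  klDiv (Q : Measure H) (P : Measure H) + ENNReal.ofReal (Real.log (4 * √(n : ℝ) / δ))

/-- `kl₂ = D_KL(Q ‖ P) + log (4 / δ)`, possibly infinite. -/
noncomputable def kl₂ (δ : ℝ) (P Q : ProbabilityMeasure H) : ℝ≥0∞ :=
  klDiv (Q : Measure H) (P : Measure H) + ENNReal.ofReal (Real.log (4 / δ))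

/-- The learning objective
`R̂_n^α(π_Q) + √(kl₁/(2n)) + B_n^α(π_Q) + kl₂/(nλ) + (λ/2) V̄_n^α(π_Q)`,
which is `+∞` exactly when `D_KL(Q ‖ P) = ∞`. -/
noncomputable def objective (ev : H → X → Fin K) (hev : Measurable (Function.uncurry ev))
    (π₀ : Kernel X (Fin K)) (P : ProbabilityMeasure H) (α lam δ : ℝ) {n : ℕ}
    (D : Fin n → Sample X K) (Q : ProbabilityMeasure H) : EReal :=
  (estRisk α π₀ (policy ev hev Q) D : EReal)
    + ((kl₁ n δ P Q / (2 * (n : ℝ≥0∞))) ^ (1 / 2 : ℝ) : ℝ≥0∞)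
    + (bias α π₀ (policy ev hev Q) D : EReal)
    + (kl₂ δ P Q / ENNReal.ofReal ((n : ℝ) * lam) : ℝ≥0∞)
    + ((lam / 2 * secondMoment α π₀ (policy ev hev Q) D : ℝ) : EReal)

end Posterior

end OffPolicy

/-!
Everything follows from a two-sided confidence bound for `R(π_Q)` around `R̂_n^α(π_Q)` that holds
for all posteriors `Q` at once: its half-width is exactly what the objective adds to `R̂_n^α`, so
`R(π_Qhat) ≤ objective(Qhat) ≤ objective(Qstar) ≤ R(π_Qstar) + 2 · width(Qstar)`. If
`D_KL(Qstar ‖ P) = ∞`, the right-hand side is `+∞`.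

The error is split by conditioning on the contexts. Write `m(x, a) = E[c | x, a]`.

* The average of `E_{a ∼ π_Q} m(xᵢ, a)` fluctuates around `R(π_Q)`
  (`exists_event_context_deviation`). The PAC-Bayes change of measure (`exists_pacBayes_event`),
  applied to `2 n` times the squared deviation of a single hypothesis, needs the moment bound
  `E exp(2 n Y²) ≤ 2 √n` (`lintegral_exp_two_mul_sq_le`). It comes from Hoeffding's lemma and a
  Gaussian mixture truncated to the range of `Y`, with no reduction to the binomial law.
* Smoothing the weights changes the conditional mean by at most `B_n^α`
  (`abs_integral_smoothedMean_sub_le`). For `α = 1` this is where the support condition enters.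
* Given the contexts, the estimator fluctuates around its conditional mean
  (`exists_event_action_deviation`). The change of measure is applied to an exponential
  supermartingale with a quadratic compensator, which rests on
  `exp (w - w² / 2) ≤ 1 + w + w² / 2` for all real `w` (`exp_sub_sq_half_le`). Unbounded weights are
  therefore allowed.

Each quantity is an average over `h ∼ Q` of a function of a single hypothesis, because `π_Q` is
linear in `Q`; this is what makes the change of measure applicable.
-/

namespace OffPolicy

/-! ### The PAC-Bayes change of measure -/

section PacBayes

variable {Ω H : Type*} [MeasurableSpace Ω] [MeasurableSpace H]

/-- The easy half of the Donsker–Varadhan variational formula. It is Gibbs' inequality for `Q`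
against the exponential tilt of `P` by `f`. -/
theorem integral_le_klDiv_add_log_integral_exp (P Q : Measure H) [IsProbabilityMeasure P]
    [IsProbabilityMeasure Q] {f : H → ℝ} (hkl : klDiv Q P ≠ ∞) (hfQ : Integrable f Q)
    (hfP : Integrable (fun h => Real.exp (f h)) P) :
    ∫ h, f h ∂Q ≤ (klDiv Q P).toReal + Real.log (∫ h, Real.exp (f h) ∂P) := by
  obtain ⟨hac, hint⟩ := klDiv_ne_top_iff.1 hkl
  have := isProbabilityMeasure_tilted hfP
  have h1 := integral_llr_add_sub_measure_univ_nonneg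
    (hac.trans (absolutelyContinuous_tilted hfP))
    (integrable_llr_tilted_right hac hfQ hint hfP)
  rw [integral_llr_tilted_right hac hfQ hfP hint] at h1
  rw [toReal_klDiv hac hint]
  simp only [probReal_univ] at h1 ⊢
  linarith

/-- The PAC-Bayes template: an exponential moment bound for each single hypothesis yields a bound
on all posterior averages at once, outside an event of probability at most `δ`. -/
theorem exists_pacBayes_event (μ : Measure Ω) [IsProbabilityMeasure μ]
    (P : Measure H) [IsProbabilityMeasure P] {F : H → Ω → ℝ}
    (hF : Measurable (Function.uncurry F)) {M δ : ℝ} (hM : 0 < M) (hδ : 0 < δ)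
    (hexp : ∀ h, ∫⁻ ω, ENNReal.ofReal (Real.exp (F h ω)) ∂μ ≤ ENNReal.ofReal M) :
    ∃ E : Set Ω, MeasurableSet E ∧ μ Eᶜ ≤ ENNReal.ofReal δ ∧
      ∀ ω ∈ E, ∀ Q : Measure H, IsProbabilityMeasure Q → klDiv Q P ≠ ∞ →
        Integrable (fun h => F h ω) Q →
        ∫ h, F h ω ∂Q ≤ (klDiv Q P).toReal + Real.log (M / δ) := by
  have hm : Measurable fun z : H × Ω => ENNReal.ofReal (Real.exp (F z.1 z.2)) :=
    (Real.measurable_exp.comp hF).ennreal_ofReal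
  set G : Ω → ℝ≥0∞ := fun ω => ∫⁻ h, ENNReal.ofReal (Real.exp (F h ω)) ∂P with hG
  have hGm : Measurable G := hm.lintegral_prod_left'
  have hMδ : 0 < M / δ := div_pos hM hδ
  refine ⟨{ω | G ω < ENNReal.ofReal (M / δ)}, measurableSet_lt hGm measurable_const, ?_, ?_⟩
  · have hGint : ∫⁻ ω, G ω ∂μ ≤ ENNReal.ofReal M := by
      calc ∫⁻ ω, G ω ∂μ = ∫⁻ h, ∫⁻ ω, ENNReal.ofReal (Real.exp (F h ω)) ∂μ ∂P :=
            lintegral_lintegral_swap (f := fun ω h => ENNReal.ofReal (Real.exp (F h ω)))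
              (hm.comp measurable_swap).aemeasurable
        _ ≤ ∫⁻ _, ENNReal.ofReal M ∂P := lintegral_mono hexp
        _ = ENNReal.ofReal M := by simp
    have hset : {ω | G ω < ENNReal.ofReal (M / δ)}ᶜ = {ω | ENNReal.ofReal (M / δ) ≤ G ω} := by
      ext ω; simp
    rw [hset]
    refine (meas_ge_le_lintegral_div hGm.aemeasurable (by simpa using hMδ)
      ENNReal.ofReal_ne_top).trans ?_
    refine (ENNReal.div_le_div_right hGint _).trans ?_
    rw [← ENNReal.ofReal_div_of_pos hMδ, div_div_cancel₀ hM.ne']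
  · intro ω hω Q _ hkl hint
    have hFω : Measurable fun h => F h ω := hF.comp (measurable_id.prodMk measurable_const)
    have hP : Integrable (fun h => Real.exp (F h ω)) P := by
      refine ⟨(Real.measurable_exp.comp hFω).aestronglyMeasurable, ?_⟩
      rw [hasFiniteIntegral_iff_ofReal (.of_forall fun h => (Real.exp_pos _).le)]
      exact (show G ω < _ from hω).trans ENNReal.ofReal_lt_top
    refine (integral_le_klDiv_add_log_integral_exp P Q hkl hint hP).trans ?_
    have hle : ∫ h, Real.exp (F h ω) ∂P ≤ M / δ := by
      rw [← ENNReal.ofReal_le_ofReal_iff hMδ.le,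
        ofReal_integral_eq_lintegral_ofReal hP (.of_forall fun h => (Real.exp_pos _).le)]
      exact (show G ω < _ from hω).le
    gcongr
    exact integral_exp_pos hP

end PacBayes

/-- The exponential moment of a sum of functions of independent coordinates factorizes. -/
theorem lintegral_pi_exp_sum_le {Z : Type*} [MeasurableSpace Z] (μ : Measure Z)
    [IsProbabilityMeasure μ] {n : ℕ} {g : Z → ℝ} (hg : Measurable g) {b : ℝ}
    (hb : ∫⁻ z, ENNReal.ofReal (Real.exp (g z)) ∂μ ≤ ENNReal.ofReal (Real.exp b)) :
    ∫⁻ D, ENNReal.ofReal (Real.exp (∑ i, g (D i))) ∂(Measure.pi fun _ : Fin n => μ)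
      ≤ ENNReal.ofReal (Real.exp (n * b)) := by
  have hm : Measurable fun z => ENNReal.ofReal (Real.exp (g z)) :=
    (Real.measurable_exp.comp hg).ennreal_ofReal
  have h1 : ∀ D : Fin n → Z, ENNReal.ofReal (Real.exp (∑ i, g (D i)))
      = ∏ i, ENNReal.ofReal (Real.exp (g (D i))) := fun D => by
    rw [Real.exp_sum, ENNReal.ofReal_prod_of_nonneg fun i _ => (Real.exp_pos _).le]
  have hind : iIndepFun (fun (i : Fin n) (D : Fin n → Z) => ENNReal.ofReal (Real.exp (g (D i))))
      (Measure.pi fun _ : Fin n => μ) := iIndepFun_pi fun _ => hm.aemeasurable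
  simp_rw [h1]
  rw [lintegral_prod_eq_prod_lintegral_of_indepFun _ _ hind
    fun i => hm.comp (measurable_pi_apply i)]
  have h2 : ∀ i : Fin n, ∫⁻ D, ENNReal.ofReal (Real.exp (g (D i)))
      ∂(Measure.pi fun _ : Fin n => μ) = ∫⁻ z, ENNReal.ofReal (Real.exp (g z)) ∂μ := fun i =>
    (measurePreserving_eval (fun _ : Fin n => μ) i).lintegral_comp hm
  simp_rw [h2]
  rw [Finset.prod_const, Finset.card_univ, Fintype.card_fin, Real.exp_nat_mul,
    ENNReal.ofReal_pow (Real.exp_pos _).le]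
  gcongr

/-! ### The critical exponential moment of a bounded empirical mean -/

/-- A unit Gaussian bump keeps mass at least `1` on any interval of length `2` that contains its
centre. -/
theorem one_le_integral_exp_neg_sq {a y : ℝ} (h1 : a ≤ y) (h2 : y ≤ a + 2) :
    1 ≤ ∫ v in a..(a + 2), Real.exp (-(v - y) ^ 2 / 2) := by
  have he : Real.exp (1 / 2) ≤ 5 / 3 := by
    rw [Real.exp_half, Real.sqrt_le_left (by norm_num)]
    exact Real.exp_one_lt_d9.le.trans (by norm_num)
  have he' : 3 / 5 ≤ Real.exp (-(1 / 2)) := by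
    rw [Real.exp_neg, ← inv_inv (3 / 5 : ℝ)]
    exact inv_anti₀ (Real.exp_pos _) (by linarith)
  -- the tangent line of `exp` at `-1/2`
  have hlow : ∀ v : ℝ, Real.exp (-(1 / 2)) * (3 / 2 - (v - y) ^ 2 / 2)
      ≤ Real.exp (-(v - y) ^ 2 / 2) := fun v => by
    have h3 := Real.add_one_le_exp (1 / 2 - (v - y) ^ 2 / 2)
    have h4 : Real.exp (-(v - y) ^ 2 / 2)
        = Real.exp (-(1 / 2)) * Real.exp (1 / 2 - (v - y) ^ 2 / 2) := by
      rw [← Real.exp_add]; congr 1; ring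
    rw [h4]
    exact mul_le_mul_of_nonneg_left (by linarith) (Real.exp_pos _).le
  have hder : ∀ v : ℝ, HasDerivAt (fun v => 3 / 2 * v - (v - y) ^ 3 / 6)
      (3 / 2 - (v - y) ^ 2 / 2) v := fun v => by
    have := ((hasDerivAt_id v).const_mul (3 / 2)).sub
      ((((hasDerivAt_id v).sub_const y).pow 3).div_const 6)
    refine this.congr_deriv ?_
    simp; ring
  have hcalc : ∫ v in a..(a + 2), (3 / 2 - (v - y) ^ 2 / 2)
      = (3 / 2 * (a + 2) - (a + 2 - y) ^ 3 / 6) - (3 / 2 * a - (a - y) ^ 3 / 6) :=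
    intervalIntegral.integral_eq_sub_of_hasDerivAt (fun v _ => hder v)
      ((by fun_prop : Continuous fun v : ℝ => 3 / 2 - (v - y) ^ 2 / 2).intervalIntegrable _ _)
  have hmono := intervalIntegral.integral_mono_on (a := a) (b := a + 2) (by linarith)
    ((by fun_prop : Continuous fun v : ℝ =>
      Real.exp (-(1 / 2)) * (3 / 2 - (v - y) ^ 2 / 2)).intervalIntegrable _ _)
    ((by fun_prop : Continuous fun v : ℝ =>
      Real.exp (-(v - y) ^ 2 / 2)).intervalIntegrable (μ := volume) _ _) (fun v _ => hlow v)
  rw [intervalIntegral.integral_const_mul, hcalc] at hmono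
  have h5 : 5 / 3 ≤ (3 / 2 * (a + 2) - (a + 2 - y) ^ 3 / 6) - (3 / 2 * a - (a - y) ^ 3 / 6) := by
    nlinarith [mul_nonneg (sub_nonneg.2 h1) (sub_nonneg.2 h2)]
  nlinarith

/-- The same on any interval of length at least `2`. -/
theorem one_le_lintegral_exp_neg_sq {a b y : ℝ} (hab : a + 2 ≤ b) (h1 : a ≤ y) (h2 : y ≤ b) :
    1 ≤ ∫⁻ v in Set.Icc a b, ENNReal.ofReal (Real.exp (-(v - y) ^ 2 / 2)) := by
  obtain ⟨a', ha1, ha2, ha3, ha4⟩ : ∃ a', a ≤ a' ∧ a' + 2 ≤ b ∧ a' ≤ y ∧ y ≤ a' + 2 := by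
    refine ⟨max a (y - 2), le_max_left _ _, ?_, max_le h1 (by linarith), ?_⟩
    · rw [← le_sub_iff_add_le]
      exact max_le (by linarith) (by linarith)
    · linarith [le_max_right a (y - 2)]
  have hc : Continuous fun v : ℝ => Real.exp (-(v - y) ^ 2 / 2) := by fun_prop
  calc (1 : ℝ≥0∞) = ENNReal.ofReal 1 := by simp
    _ ≤ ENNReal.ofReal (∫ v in a'..(a' + 2), Real.exp (-(v - y) ^ 2 / 2)) :=
        ENNReal.ofReal_le_ofReal (one_le_integral_exp_neg_sq ha3 ha4)
    _ = ∫⁻ v in Set.Ioc a' (a' + 2), ENNReal.ofReal (Real.exp (-(v - y) ^ 2 / 2)) := by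
        rw [intervalIntegral.integral_of_le (by linarith),
          ofReal_integral_eq_lintegral_ofReal _ (.of_forall fun v => (Real.exp_pos _).le)]
        exact (intervalIntegrable_iff_integrableOn_Ioc_of_le (by linarith)).1
          (hc.intervalIntegrable _ _)
    _ ≤ _ := lintegral_mono_set
        (Set.Ioc_subset_Icc_self.trans (Set.Icc_subset_Icc ha1 ha2))

/-- If `Y` ranges over an interval of unit length and is sub-Gaussian with variance proxy
`1 / (4 n)`, then `E exp(2 n Y²) ≤ 2 √n`. The exponent is the critical one, at which the bound for
a general sub-Gaussian variable diverges. Linearizing the square by a Gaussian mixture over only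
those parameters which a value of `Y` can select keeps the mixture finite. -/
theorem lintegral_exp_two_mul_sq_le {Ω : Type*} [MeasurableSpace Ω] (μ : Measure Ω)
    [IsProbabilityMeasure μ] {Y : Ω → ℝ} (hY : Measurable Y) {l : ℝ}
    (hl : ∀ ω, Y ω ∈ Set.Icc l (l + 1)) {n : ℕ} (hn : 1 ≤ n)
    (hmgf : ∀ s : ℝ, ∫⁻ ω, ENNReal.ofReal (Real.exp (s * Y ω)) ∂μ
      ≤ ENNReal.ofReal (Real.exp (s ^ 2 / (8 * n)))) :
    ∫⁻ ω, ENNReal.ofReal (Real.exp (2 * n * Y ω ^ 2)) ∂μ ≤ ENNReal.ofReal (2 * √(n : ℝ)) := by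
  have hn' : (1 : ℝ) ≤ n := by exact_mod_cast hn
  set T : ℝ := 2 * √(n : ℝ) with hT
  have hT2 : T ^ 2 = 4 * n := by rw [hT, mul_pow, Real.sq_sqrt (by linarith)]; norm_num
  have hTle : 2 ≤ T := by
    have : 1 ≤ √(n : ℝ) := by rw [Real.one_le_sqrt]; exact hn'
    linarith
  -- completing the square in `v` turns the mixture into a Gaussian bump centred at `T * Y ω`,
  -- which lies in the window of integration
  have hpt : ∀ ω, ENNReal.ofReal (Real.exp (2 * n * Y ω ^ 2))
      ≤ ∫⁻ v in Set.Icc (T * l) (T * (l + 1)),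
          ENNReal.ofReal (Real.exp (v * T * Y ω - v ^ 2 / 2)) := fun ω => by
    have h1 := one_le_lintegral_exp_neg_sq (a := T * l) (b := T * (l + 1)) (y := T * Y ω)
      (by linarith) (mul_le_mul_of_nonneg_left (hl ω).1 (by linarith))
      (mul_le_mul_of_nonneg_left (hl ω).2 (by linarith))
    have h2 : ∀ v : ℝ, ENNReal.ofReal (Real.exp (v * T * Y ω - v ^ 2 / 2))
        = ENNReal.ofReal (Real.exp (2 * n * Y ω ^ 2))
          * ENNReal.ofReal (Real.exp (-(v - T * Y ω) ^ 2 / 2)) := fun v => by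
      rw [← ENNReal.ofReal_mul (Real.exp_pos _).le, ← Real.exp_add]
      congr 2
      linear_combination (Y ω) ^ 2 / 2 * hT2
    simp_rw [h2]
    rw [lintegral_const_mul _ (by fun_prop)]
    exact le_mul_of_one_le_right' h1
  have hmeas : Measurable fun z : Ω × ℝ =>
      ENNReal.ofReal (Real.exp (z.2 * T * Y z.1 - z.2 ^ 2 / 2)) := by fun_prop
  calc ∫⁻ ω, ENNReal.ofReal (Real.exp (2 * n * Y ω ^ 2)) ∂μ
      ≤ ∫⁻ ω, (∫⁻ v in Set.Icc (T * l) (T * (l + 1)),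
          ENNReal.ofReal (Real.exp (v * T * Y ω - v ^ 2 / 2))) ∂μ := lintegral_mono hpt
    _ = ∫⁻ v in Set.Icc (T * l) (T * (l + 1)), ∫⁻ ω,
          ENNReal.ofReal (Real.exp (v * T * Y ω - v ^ 2 / 2)) ∂μ :=
        lintegral_lintegral_swap hmeas.aemeasurable
    _ ≤ ∫⁻ v in Set.Icc (T * l) (T * (l + 1)), 1 := by
        refine lintegral_mono fun v => ?_
        have h3 : ∀ ω, ENNReal.ofReal (Real.exp (v * T * Y ω - v ^ 2 / 2))
            = ENNReal.ofReal (Real.exp (v * T * Y ω))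
              * ENNReal.ofReal (Real.exp (-(v ^ 2 / 2))) := fun ω => by
          rw [← ENNReal.ofReal_mul (Real.exp_pos _).le, ← Real.exp_add]; rfl
        simp_rw [h3]
        rw [lintegral_mul_const _ (by fun_prop)]
        refine (mul_le_mul_left (hmgf (v * T)) _).trans ?_
        rw [← ENNReal.ofReal_mul (Real.exp_pos _).le, ← Real.exp_add, mul_pow, hT2]
        have h4 : v ^ 2 * (4 * (n : ℝ)) / (8 * n) + -(v ^ 2 / 2) = 0 := by
          field_simp; ring
        rw [h4]; simp
    _ = ENNReal.ofReal T := by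
        rw [setLIntegral_one, Real.volume_Icc]; congr 1; ring

theorem average_mem_Icc {n : ℕ} (hn : 1 ≤ n) {f : Fin n → ℝ}
    (hf : ∀ i, f i ∈ Set.Icc (-1 : ℝ) 0) : (1 / (n : ℝ)) * ∑ i, f i ∈ Set.Icc (-1 : ℝ) 0 := by
  have hn' : (0 : ℝ) < n := by exact_mod_cast hn
  have h1 : -(n : ℝ) ≤ ∑ i, f i := by
    simpa using Finset.card_nsmul_le_sum Finset.univ f (-1) fun i _ => (hf i).1
  refine ⟨?_, mul_nonpos_of_nonneg_of_nonpos (by positivity)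
    (Finset.sum_nonpos fun i _ => (hf i).2)⟩
  rw [one_div, inv_mul_eq_div, le_div_iff₀ hn']
  linarith

/-- Maurer's moment bound for an empirical mean, with the square of the deviation in place of the
binary relative entropy. -/
theorem lintegral_pi_exp_two_mul_sq_le {Z : Type*} [MeasurableSpace Z] (μ : Measure Z)
    [IsProbabilityMeasure μ] {g : Z → ℝ} (hg : Measurable g)
    (hgI : ∀ z, g z ∈ Set.Icc (-1 : ℝ) 0) {n : ℕ} (hn : 1 ≤ n) :
    ∫⁻ D, ENNReal.ofReal
        (Real.exp (2 * n * ((1 / (n : ℝ)) * ∑ i, g (D i) - ∫ z, g z ∂μ) ^ 2))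
        ∂(Measure.pi fun _ : Fin n => μ) ≤ ENNReal.ofReal (2 * √(n : ℝ)) := by
  refine lintegral_exp_two_mul_sq_le (l := -1 - ∫ z, g z ∂μ) _ (by fun_prop) (fun D => ?_) hn
    (fun s => ?_)
  · have h := average_mem_Icc hn fun i => hgI (D i)
    constructor <;> linarith [h.1, h.2]
  · have hn' : (0 : ℝ) < n := by exact_mod_cast hn
    have hsg := hasSubgaussianMGF_of_mem_Icc (μ := μ) hg.aemeasurable (.of_forall hgI)
    have hone : ∫⁻ z, ENNReal.ofReal (Real.exp (s / n * (g z - ∫ z, g z ∂μ))) ∂μ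
        ≤ ENNReal.ofReal (Real.exp ((s / n) ^ 2 / 8)) := by
      rw [← ofReal_integral_eq_lintegral_ofReal (hsg.integrable_exp_mul _)
        (.of_forall fun z => (Real.exp_pos _).le)]
      refine ENNReal.ofReal_le_ofReal ((hsg.mgf_le (s / n)).trans (Real.exp_le_exp.2 ?_))
      apply le_of_eq
      norm_num
      ring
    have h := lintegral_pi_exp_sum_le (n := n) μ (by fun_prop) hone
    have e1 : ∀ D : Fin n → Z, ∑ i, s / n * (g (D i) - ∫ z, g z ∂μ)
        = s * ((1 / (n : ℝ)) * ∑ i, g (D i) - ∫ z, g z ∂μ) := fun D => by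
      rw [← Finset.mul_sum, Finset.sum_sub_distrib]
      simp only [Finset.sum_const, Finset.card_univ, Fintype.card_fin, nsmul_eq_mul]
      field_simp
    have e2 : (n : ℝ) * ((s / n) ^ 2 / 8) = s ^ 2 / (8 * n) := by field_simp
    simp_rw [e1, e2] at h
    exact h

/-! ### A self-bounded exponential inequality -/

theorem exp_sub_sq_half_le (w : ℝ) : Real.exp (w - w ^ 2 / 2) ≤ 1 + w + w ^ 2 / 2 := by
  have h1 : 0 < 1 - w + w ^ 2 / 2 := by nlinarith [sq_nonneg (w - 1)]
  have h2 : 1 - w + w ^ 2 / 2 ≤ Real.exp (-(w - w ^ 2 / 2)) := by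
    have := Real.add_one_le_exp (-(w - w ^ 2 / 2)); linarith
  have h3 : Real.exp (w - w ^ 2 / 2) * Real.exp (-(w - w ^ 2 / 2)) = 1 := by
    rw [← Real.exp_add]; simp
  -- `(1 - w + w² / 2) (1 + w + w² / 2) = 1 + w⁴ / 4`
  have h4 : 1 ≤ (1 + w + w ^ 2 / 2) * (1 - w + w ^ 2 / 2) := by
    nlinarith [sq_nonneg (w ^ 2)]
  refine le_of_mul_le_mul_right ?_ h1
  calc Real.exp (w - w ^ 2 / 2) * (1 - w + w ^ 2 / 2)
      ≤ Real.exp (w - w ^ 2 / 2) * Real.exp (-(w - w ^ 2 / 2)) :=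
        mul_le_mul_of_nonneg_left h2 (Real.exp_pos _).le
    _ = 1 := h3
    _ ≤ _ := h4

/-! ### Conditional costs and the logging law -/

section Costs

variable {X : Type*} [MeasurableSpace X] {K : ℕ}

/-- The conditional mean cost `E[c | x, a]`. -/
noncomputable def meanCost (p : Kernel (X × Fin K) ℝ) (x : X) (a : Fin K) : ℝ :=
  ∫ c, c ∂(p (x, a))

theorem measurable_prob (π : Kernel X (Fin K)) :
    Measurable fun z : X × Fin K => prob π z.2 z.1 :=
  measurable_from_prod_countable_left fun a =>
    (π.measurable_coe (measurableSet_singleton a)).ennreal_toReal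

theorem prob_nonneg (π : Kernel X (Fin K)) (a : Fin K) (x : X) : 0 ≤ prob π a x :=
  measureReal_nonneg

theorem prob_le_one (π : Kernel X (Fin K)) [IsMarkovKernel π] (a : Fin K) (x : X) :
    prob π a x ≤ 1 :=
  measureReal_le_one

theorem integral_eq_sum_prob (π : Kernel X (Fin K)) [IsFiniteKernel π] (x : X) (f : Fin K → ℝ) :
    ∫ a, f a ∂(π x) = ∑ a, prob π a x * f a := by
  rw [integral_fintype .of_finite]
  rfl

theorem measurable_meanCost (p : Kernel (X × Fin K) ℝ) [IsMarkovKernel p] :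
    Measurable fun z : X × Fin K => meanCost p z.1 z.2 :=
  (StronglyMeasurable.integral_kernel (κ := p) (f := fun c : ℝ => c)
    measurable_id.stronglyMeasurable).measurable

variable {p : Kernel (X × Fin K) ℝ} [IsMarkovKernel p]

theorem ae_cost_mem_Icc (hcost : ∀ xa, p xa (Set.Icc (-1) 0) = 1) (xa : X × Fin K) :
    ∀ᵐ c ∂(p xa), c ∈ Set.Icc (-1 : ℝ) 0 :=
  (mem_ae_iff_prob_eq_one measurableSet_Icc).2 (hcost xa)

theorem meanCost_mem_Icc (hcost : ∀ xa, p xa (Set.Icc (-1) 0) = 1) (x : X) (a : Fin K) :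
    meanCost p x a ∈ Set.Icc (-1 : ℝ) 0 :=
  (convex_Icc (-1 : ℝ) 0).integral_mem isClosed_Icc (ae_cost_mem_Icc hcost _)
    (Integrable.of_mem_Icc _ _ aemeasurable_id (ae_cost_mem_Icc hcost _))

variable (ν : Measure X) [IsProbabilityMeasure ν]

instance (π : Kernel X (Fin K)) [IsMarkovKernel π] : IsProbabilityMeasure (jointLaw ν p π) := by
  unfold jointLaw; infer_instance

theorem measurePreserving_context (π : Kernel X (Fin K)) [IsMarkovKernel π] :
    MeasurePreserving (fun z : Sample X K => z.1.1) (jointLaw ν p π) ν := by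
  refine ⟨by fun_prop, ?_⟩
  have : (jointLaw ν p π).map (fun z : Sample X K => z.1.1) = (jointLaw ν p π).fst.fst := by
    rw [Measure.fst, Measure.fst, Measure.map_map measurable_fst measurable_fst]
    rfl
  rw [this, jointLaw, Measure.fst_compProd, Measure.fst_compProd]

theorem risk_eq_integral_meanCost (hcost : ∀ xa, p xa (Set.Icc (-1) 0) = 1)
    (π : Kernel X (Fin K)) [IsMarkovKernel π] :
    risk ν p π = ∫ x, ∫ a, meanCost p x a ∂(π x) ∂ν := by
  have hae : ∀ᵐ z ∂(jointLaw ν p π), z.2 ∈ Set.Icc (-1 : ℝ) 0 := by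
    refine Measure.ae_compProd_of_ae_ae (measurable_snd measurableSet_Icc) ?_
    exact .of_forall fun xa => ae_cost_mem_Icc hcost xa
  have hint : Integrable (fun z : Sample X K => z.2) (jointLaw ν p π) :=
    Integrable.of_mem_Icc _ _ measurable_snd.aemeasurable hae
  have hint' : Integrable (fun z : X × Fin K => meanCost p z.1 z.2) (ν.compProd π) :=
    Integrable.of_mem_Icc (-1) 0 (measurable_meanCost p).aemeasurable
      (.of_forall fun z => meanCost_mem_Icc hcost _ _)
  rw [risk, jointLaw, Measure.integral_compProd hint]
  exact Measure.integral_compProd hint'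

end Costs

section Policy

variable {X : Type*} [MeasurableSpace X] {K : ℕ} {H : Type*} [MeasurableSpace H]
  {ev : H → X → Fin K} (hev : Measurable (Function.uncurry ev)) (Q : ProbabilityMeasure H)

include hev in
theorem measurable_ev_apply (x : X) : Measurable fun h => ev h x :=
  hev.comp (measurable_id.prodMk measurable_const)

instance : IsMarkovKernel (policy ev hev Q) :=
  ⟨fun x => Measure.isProbabilityMeasure_map (measurable_ev_apply hev x).aemeasurable⟩

theorem integral_policy (x : X) (f : Fin K → ℝ) :
    ∫ a, f a ∂(policy ev hev Q x) = ∫ h, f (ev h x) ∂(Q : Measure H) :=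
  integral_map (measurable_ev_apply hev x).aemeasurable
    (measurable_of_finite f).aestronglyMeasurable

include hev in
theorem integrable_comp_ev (x : X) (f : Fin K → ℝ) :
    Integrable (fun h => f (ev h x)) (Q : Measure H) := by
  have : Integrable f ((Q : Measure H).map fun h => ev h x) := .of_finite
  exact this.comp_measurable (measurable_ev_apply hev x)

theorem prob_policy_eq_zero_of_ac {P : ProbabilityMeasure H}
    (hQ : (Q : Measure H) ≪ (P : Measure H)) {x : X} {a : Fin K}
    (h0 : prob (policy ev hev P) a x = 0) : prob (policy ev hev Q) a x = 0 := by
  have h1 : (policy ev hev Q x) ≪ (policy ev hev P x) := hQ.map (measurable_ev_apply hev x)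
  rw [prob, measureReal_eq_zero_iff] at h0 ⊢
  exact h1 h0

theorem risk_policy {p : Kernel (X × Fin K) ℝ} [IsMarkovKernel p] (ν : Measure X)
    [IsProbabilityMeasure ν] (hcost : ∀ xa, p xa (Set.Icc (-1) 0) = 1) :
    risk ν p (policy ev hev Q) = ∫ h, ∫ x, meanCost p x (ev h x) ∂ν ∂(Q : Measure H) := by
  rw [risk_eq_integral_meanCost ν hcost]
  simp_rw [integral_policy]
  have hm : Measurable fun z : X × H => meanCost p z.1 (ev z.2 z.1) :=
    (measurable_meanCost p).comp (measurable_fst.prodMk (hev.comp measurable_swap))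
  exact integral_integral_swap (f := fun x h => meanCost p x (ev h x))
    (Integrable.of_mem_Icc (-1) 0 hm.aemeasurable
      (.of_forall fun z => meanCost_mem_Icc hcost _ _))

end Policy

/-! ### Fluctuation of the contexts -/

section Contexts

variable {X : Type*} [MeasurableSpace X] {K : ℕ} {H : Type*} [MeasurableSpace H]
  {ev : H → X → Fin K} (hev : Measurable (Function.uncurry ev))
  {p : Kernel (X × Fin K) ℝ} [IsMarkovKernel p] (hcost : ∀ xa, p xa (Set.Icc (-1) 0) = 1)
  (ν : Measure X) [IsProbabilityMeasure ν] (π₀ : Kernel X (Fin K)) [IsMarkovKernel π₀]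

theorem sq_integral_le_integral_sq {Ω : Type*} [MeasurableSpace Ω] (μ : Measure Ω)
    [IsProbabilityMeasure μ] {Y : Ω → ℝ} (hY : Integrable Y μ)
    (hY2 : Integrable (fun ω => Y ω ^ 2) μ) : (∫ ω, Y ω ∂μ) ^ 2 ≤ ∫ ω, Y ω ^ 2 ∂μ :=
  (even_two.convexOn_pow (𝕜 := ℝ)).map_integral_le (continuous_pow 2).continuousOn isClosed_univ
    (.of_forall fun _ => Set.mem_univ _) hY hY2

include hev hcost in
/-- Uniformly over the posteriors, the risk is close to its average over the observed contexts. -/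
theorem exists_event_context_deviation (P : ProbabilityMeasure H) {n : ℕ} (hn : 1 ≤ n) {δ : ℝ}
    (hδ : 0 < δ) :
    ∃ E : Set (Fin n → Sample X K), MeasurableSet E ∧
      (Measure.pi fun _ : Fin n => jointLaw ν p π₀) Eᶜ ≤ ENNReal.ofReal δ ∧
      ∀ D ∈ E, ∀ Q : ProbabilityMeasure H, klDiv (Q : Measure H) (P : Measure H) ≠ ∞ →
        |(1 / (n : ℝ)) * ∑ i, ∫ a, meanCost p (D i).1.1 a ∂(policy ev hev Q (D i).1.1)
            - risk ν p (policy ev hev Q)|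
          ≤ √(((klDiv (Q : Measure H) (P : Measure H)).toReal
              + Real.log (2 * √(n : ℝ) / δ)) / (2 * n)) := by
  have hn' : (0 : ℝ) < n := by exact_mod_cast hn
  have hm : Measurable fun z : H × X => meanCost p z.2 (ev z.1 z.2) :=
    (measurable_meanCost p).comp (measurable_snd.prodMk hev)
  have hmI : ∀ h x, meanCost p x (ev h x) ∈ Set.Icc (-1 : ℝ) 0 := fun h x =>
    meanCost_mem_Icc hcost _ _
  set r : H → ℝ := fun h => ∫ x, meanCost p x (ev h x) ∂ν with hr
  have hrm : Measurable r := (hm.stronglyMeasurable.integral_prod_right (ν := ν)).measurable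
  have hrI : ∀ h, r h ∈ Set.Icc (-1 : ℝ) 0 := fun h =>
    (convex_Icc (-1 : ℝ) 0).integral_mem isClosed_Icc (.of_forall (hmI h))
      (Integrable.of_mem_Icc (-1) 0
        (hm.comp (measurable_const.prodMk measurable_id)).aemeasurable (.of_forall (hmI h)))
  set Y : H → (Fin n → Sample X K) → ℝ := fun h D =>
    (1 / (n : ℝ)) * ∑ i, meanCost p (D i).1.1 (ev h (D i).1.1) - r h with hY
  have hYm : Measurable (Function.uncurry Y) := by
    refine (Measurable.const_mul (Finset.measurable_sum _ fun i _ => ?_) _).sub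
      (hrm.comp measurable_fst)
    exact hm.comp (measurable_fst.prodMk (measurable_fst.comp (measurable_fst.comp
      ((measurable_pi_apply i).comp measurable_snd))))
  obtain ⟨E, hE, hEδ, hEQ⟩ := exists_pacBayes_event
    (Measure.pi fun _ : Fin n => jointLaw ν p π₀) (P : Measure H)
    (F := fun h D => 2 * n * Y h D ^ 2) ((hYm.pow_const 2).const_mul _)
    (M := 2 * √(n : ℝ)) (by positivity) hδ (fun h => by
      have hg : Measurable fun x => meanCost p x (ev h x) :=
        hm.comp (measurable_const.prodMk measurable_id)
      have h1 := lintegral_pi_exp_two_mul_sq_le (jointLaw ν p π₀)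
        (g := fun z => meanCost p z.1.1 (ev h z.1.1)) (hg.comp (by fun_prop))
        (fun z => hmI h _) hn
      have h2 : ∫ z, meanCost p z.1.1 (ev h z.1.1) ∂(jointLaw ν p π₀) = r h := by
        have hmp := measurePreserving_context (p := p) ν π₀
        have h3 := integral_map (μ := jointLaw ν p π₀) hmp.measurable.aemeasurable
          hg.aestronglyMeasurable
        rw [hmp.map_eq] at h3
        exact h3.symm
      rw [h2] at h1
      exact h1)
  refine ⟨E, hE, hEδ, fun D hD Q hkl => ?_⟩
  have hint_i : ∀ i, Integrable (fun h => meanCost p (D i).1.1 (ev h (D i).1.1))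
      (Q : Measure H) := fun i => integrable_comp_ev hev Q _ _
  have hrint : Integrable r (Q : Measure H) :=
    Integrable.of_mem_Icc (-1) 0 hrm.aemeasurable (.of_forall hrI)
  have hYint : Integrable (fun h => Y h D) (Q : Measure H) :=
    ((integrable_finsetSum _ fun i _ => hint_i i).const_mul _).sub hrint
  have hYmD : Measurable fun h => Y h D := hYm.comp (measurable_id.prodMk measurable_const)
  have hYb : ∀ h, |Y h D| ≤ 1 := fun h => by
    have h1 := average_mem_Icc hn fun i => hmI h (D i).1.1
    rw [abs_le]
    constructor <;> simp only [hY] <;> linarith [(hrI h).1, (hrI h).2, h1.1, h1.2]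
  have hY2int : Integrable (fun h => Y h D ^ 2) (Q : Measure H) :=
    Integrable.of_mem_Icc 0 1 (hYmD.pow_const 2).aemeasurable
      (.of_forall fun h => ⟨sq_nonneg _, (sq_le_one_iff_abs_le_one _).2 (hYb h)⟩)
  have hmain := hEQ D hD (Q : Measure H) inferInstance hkl (hY2int.const_mul _)
  rw [integral_const_mul] at hmain
  have hEY : ∫ h, Y h D ∂(Q : Measure H) =
      (1 / (n : ℝ)) * ∑ i, ∫ a, meanCost p (D i).1.1 a ∂(policy ev hev Q (D i).1.1)
            - risk ν p (policy ev hev Q) := by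
    simp only [hY]
    rw [integral_sub ((integrable_finsetSum _ fun i _ => hint_i i).const_mul _) hrint,
      integral_const_mul, integral_finsetSum _ fun i _ => hint_i i, risk_policy hev Q ν hcost]
    simp_rw [integral_policy]
    rfl
  rw [← hEY]
  refine Real.abs_le_sqrt ?_
  rw [le_div_iff₀ (by positivity)]
  have hj := sq_integral_le_integral_sq (Q : Measure H) hYint hY2int
  nlinarith

end Contexts

/-! ### Fluctuation of actions and costs given the contexts -/

section Actions

variable {X : Type*} [MeasurableSpace X] {K : ℕ} {H : Type*} [MeasurableSpace H]
  {ev : H → X → Fin K} (hev : Measurable (Function.uncurry ev))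
  {p : Kernel (X × Fin K) ℝ} [IsMarkovKernel p] (hcost : ∀ xa, p xa (Set.Icc (-1) 0) = 1)
  (ν : Measure X) [IsProbabilityMeasure ν] (π₀ : Kernel X (Fin K))

/-- The smoothed importance weight `1{b = a} / π₀(a | x)^α` of a deterministic action `b`
against the logged action `a`. -/
noncomputable def weight (α : ℝ) (π₀ : Kernel X (Fin K)) (x : X) (b a : Fin K) : ℝ :=
  if b = a then (prob π₀ a x ^ α)⁻¹ else 0

/-- The conditional mean, given the context `x`, of `c · 1{b = a} / π₀(a | x)^α` under the logging
policy, in closed form. It vanishes when `π₀(b | x) = 0`. -/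
noncomputable def smoothedMean (α : ℝ) (π₀ : Kernel X (Fin K)) (p : Kernel (X × Fin K) ℝ)
    (x : X) (b : Fin K) : ℝ :=
  prob π₀ b x * ((prob π₀ b x ^ α)⁻¹ * meanCost p x b)

/-- The conditional second moment, given the context `x`, of the weight of the action `b` under the
logging policy, in closed form. -/
noncomputable def weightSq (α : ℝ) (π₀ : Kernel X (Fin K)) (x : X) (b : Fin K) : ℝ :=
  prob π₀ b x * ((prob π₀ b x ^ α)⁻¹) ^ 2

/-- The contribution of one sample to the logarithm of the exponential supermartingale that controls
`t` times the error of the smoothed estimate for the action `b`. The compensator uses the raw second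
moments, observed and conditional; in the latter the squared cost is bounded by `1`. -/
noncomputable def increment (t α : ℝ) (π₀ : Kernel X (Fin K)) (p : Kernel (X × Fin K) ℝ)
    (b : Fin K) (z : Sample X K) : ℝ :=
  t * (z.2 * weight α π₀ z.1.1 b z.1.2 - smoothedMean α π₀ p z.1.1 b)
    - t ^ 2 / 2 * ((z.2 * weight α π₀ z.1.1 b z.1.2) ^ 2 + weightSq α π₀ z.1.1 b)

theorem inv_rpow_sq {q : ℝ} (hq : 0 ≤ q) (α : ℝ) : ((q ^ α)⁻¹) ^ 2 = (q ^ (2 * α))⁻¹ := by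
  rw [inv_pow, mul_comm, ← Real.rpow_mul_natCast hq α 2]
  norm_num

theorem measurable_increment (t α : ℝ) :
    Measurable fun z : Fin K × Sample X K => increment t α π₀ p z.1 z.2 := by
  have hp := measurable_prob π₀
  have hc := measurable_meanCost p
  refine measurable_from_prod_countable_right fun b => ?_
  have h1 : Measurable fun z : Sample X K => prob π₀ z.1.2 z.1.1 := hp.comp measurable_fst
  have h2 : Measurable fun z : Sample X K => prob π₀ b z.1.1 :=
    hp.comp ((measurable_fst.comp measurable_fst).prodMk measurable_const)
  have h3 : Measurable fun z : Sample X K => meanCost p z.1.1 b :=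
    hc.comp ((measurable_fst.comp measurable_fst).prodMk measurable_const)
  have h4 : Measurable fun z : Sample X K => weight α π₀ z.1.1 b z.1.2 := by
    refine Measurable.ite ?_ (h1.pow_const α).inv measurable_const
    exact measurableSet_eq_fun measurable_const (measurable_snd.comp measurable_fst)
  exact ((measurable_snd.mul h4).sub (h2.mul ((h2.pow_const α).inv.mul h3))).const_mul t |>.sub
    ((((measurable_snd.mul h4).pow_const 2).add
      (h2.mul ((h2.pow_const α).inv.pow_const 2))).const_mul (t ^ 2 / 2))

variable [IsMarkovKernel π₀]

include hcost in
/-- Given the context, the exponential of the increment has mean at most `1`. With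
`W = t c · weight`, the bound `exp (W - W² / 2) ≤ 1 + W + W² / 2` integrates to at most
`1 + E W + E W² / 2 ≤ exp (E W + E W² / 2)`. -/
theorem lintegral_exp_increment_le (t α : ℝ) (x : X) (b : Fin K) :
    ∫⁻ a, ∫⁻ c, ENNReal.ofReal (Real.exp (increment t α π₀ p b ((x, a), c))) ∂(p (x, a)) ∂(π₀ x)
      ≤ 1 := by
  set A := smoothedMean α π₀ p x b with hA
  set V := weightSq α π₀ x b with hV
  have hinner : ∀ a, ∫⁻ c, ENNReal.ofReal (Real.exp (increment t α π₀ p b ((x, a), c)))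
        ∂(p (x, a))
      ≤ ENNReal.ofReal (Real.exp (-(t * A + t ^ 2 / 2 * V)))
        * ENNReal.ofReal (1 + t * (weight α π₀ x b a * meanCost p x a)
            + t ^ 2 / 2 * weight α π₀ x b a ^ 2) := fun a => by
    set q := weight α π₀ x b a with hq
    have h1 : ∀ c, ENNReal.ofReal (Real.exp (increment t α π₀ p b ((x, a), c)))
        ≤ ENNReal.ofReal (Real.exp (-(t * A + t ^ 2 / 2 * V)))
          * ENNReal.ofReal (1 + t * q * c + (t * q) ^ 2 / 2 * c ^ 2) := fun c => by
      rw [← ENNReal.ofReal_mul (Real.exp_pos _).le]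
      refine ENNReal.ofReal_le_ofReal ?_
      have h2 : increment t α π₀ p b ((x, a), c)
          = -(t * A + t ^ 2 / 2 * V) + (t * q * c - (t * q * c) ^ 2 / 2) := by
        simp only [increment, hA, hV, hq]; ring
      rw [h2, Real.exp_add]
      refine mul_le_mul_of_nonneg_left ((exp_sub_sq_half_le _).trans (le_of_eq ?_))
        (Real.exp_pos _).le
      ring
    refine (lintegral_mono h1).trans ?_
    rw [lintegral_const_mul _ (by fun_prop)]
    refine mul_le_mul_right ?_ _
    have hae := ae_cost_mem_Icc hcost (x, a)
    have hi1 : Integrable (fun c : ℝ => c) (p (x, a)) :=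
      Integrable.of_mem_Icc _ _ aemeasurable_id hae
    have hi2 : Integrable (fun c : ℝ => c ^ 2) (p (x, a)) := by
      refine Integrable.of_mem_Icc 0 1 (by fun_prop) ?_
      filter_upwards [hae] with c hc
      exact ⟨sq_nonneg _, by nlinarith [hc.1, hc.2]⟩
    have hc2 : ∫ c, c ^ 2 ∂(p (x, a)) ≤ 1 := by
      calc ∫ c, c ^ 2 ∂(p (x, a)) ≤ ∫ _, (1 : ℝ) ∂(p (x, a)) := by
            refine integral_mono_ae hi2 (integrable_const _) ?_
            filter_upwards [hae] with c hc
            show c ^ 2 ≤ 1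
            nlinarith [hc.1, hc.2]
        _ = 1 := by simp
    have hi3 : Integrable (fun c : ℝ => 1 + t * q * c) (p (x, a)) :=
      (integrable_const _).add (hi1.const_mul _)
    have hi4 : Integrable (fun c : ℝ => 1 + t * q * c + (t * q) ^ 2 / 2 * c ^ 2) (p (x, a)) :=
      hi3.add (hi2.const_mul _)
    rw [← ofReal_integral_eq_lintegral_ofReal hi4 (.of_forall fun c => ?_)]
    · refine ENNReal.ofReal_le_ofReal ?_
      rw [integral_add hi3 (hi2.const_mul _), integral_add (integrable_const _)
        (hi1.const_mul _), integral_const_mul, integral_const_mul]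
      simp only [integral_const, probReal_univ, smul_eq_mul, mul_one]
      have : (t * q) ^ 2 / 2 * ∫ c, c ^ 2 ∂(p (x, a)) ≤ (t * q) ^ 2 / 2 * 1 :=
        mul_le_mul_of_nonneg_left hc2 (by positivity)
      have h3 : ∫ c, c ∂(p (x, a)) = meanCost p x a := rfl
      rw [h3]
      linarith
    · show 0 ≤ 1 + t * q * c + (t * q) ^ 2 / 2 * c ^ 2
      nlinarith [sq_nonneg (t * q * c + 1)]
  refine (lintegral_mono hinner).trans ?_
  rw [lintegral_const_mul _ (measurable_of_finite _),
    ← ofReal_integral_eq_lintegral_ofReal .of_finite (.of_forall fun a => ?_)]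
  · have hsum : ∫ a, (1 + t * (weight α π₀ x b a * meanCost p x a)
            + t ^ 2 / 2 * weight α π₀ x b a ^ 2) ∂(π₀ x) = 1 + (t * A + t ^ 2 / 2 * V) := by
      rw [integral_add .of_finite .of_finite, integral_add .of_finite .of_finite,
        integral_const_mul, integral_const_mul]
      have e1 : ∫ a, weight α π₀ x b a * meanCost p x a ∂(π₀ x) = A := by
        rw [integral_eq_sum_prob, Finset.sum_eq_single b]
        · simp [weight, hA, smoothedMean]
        · intro a _ hab; simp [weight, hab.symm]
        · simp
      have e2 : ∫ a, weight α π₀ x b a ^ 2 ∂(π₀ x) = V := by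
        rw [integral_eq_sum_prob, Finset.sum_eq_single b]
        · simp [weight, hV, weightSq]
        · intro a _ hab; simp [weight, hab.symm]
        · simp
      rw [e1, e2]
      simp only [integral_const, probReal_univ, smul_eq_mul, mul_one]
      ring
    rw [hsum, ← ENNReal.ofReal_mul (Real.exp_pos _).le, Real.exp_neg, ← ENNReal.ofReal_one]
    refine ENNReal.ofReal_le_ofReal ?_
    rw [inv_mul_le_one₀ (Real.exp_pos _), add_comm]
    exact Real.add_one_le_exp _
  · have hm := meanCost_mem_Icc hcost x a
    show 0 ≤ 1 + t * (weight α π₀ x b a * meanCost p x a) + t ^ 2 / 2 * weight α π₀ x b a ^ 2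
    have hm2 : 0 ≤ 1 - meanCost p x a ^ 2 := by nlinarith [hm.1, hm.2]
    nlinarith [sq_nonneg (1 + t * weight α π₀ x b a * meanCost p x a),
      mul_nonneg (sq_nonneg (t * weight α π₀ x b a)) hm2]

include hev hcost in
/-- Uniformly over the posteriors, `t` times the error of the smoothed estimator around its
conditional mean given the contexts is controlled by the empirical second moment. -/
theorem exists_event_action_deviation (P : ProbabilityMeasure H) {n : ℕ} (hn : 1 ≤ n) {δ : ℝ}
    (hδ : 0 < δ) (t α : ℝ) :
    ∃ E : Set (Fin n → Sample X K), MeasurableSet E ∧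
      (Measure.pi fun _ : Fin n => jointLaw ν p π₀) Eᶜ ≤ ENNReal.ofReal δ ∧
      ∀ D ∈ E, ∀ Q : ProbabilityMeasure H, klDiv (Q : Measure H) (P : Measure H) ≠ ∞ →
        t * (estRisk α π₀ (policy ev hev Q) D
            - (1 / (n : ℝ)) * ∑ i, ∫ a, smoothedMean α π₀ p (D i).1.1 a
                ∂(policy ev hev Q (D i).1.1))
          ≤ ((klDiv (Q : Measure H) (P : Measure H)).toReal + Real.log (1 / δ)) / n
            + t ^ 2 / 2 * secondMoment α π₀ (policy ev hev Q) D := by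
  have hn' : (0 : ℝ) < n := by exact_mod_cast hn
  have hinc := measurable_increment (p := p) π₀ t α
  have hF : Measurable (Function.uncurry fun (h : H) (D : Fin n → Sample X K) =>
      ∑ i, increment t α π₀ p (ev h (D i).1.1) (D i)) := by
    refine Finset.measurable_sum _ fun i _ => ?_
    have hDi : Measurable fun z : H × (Fin n → Sample X K) => z.2 i :=
      (measurable_pi_apply i).comp measurable_snd
    exact hinc.comp ((hev.comp (measurable_fst.prodMk
      (measurable_fst.comp (measurable_fst.comp hDi)))).prodMk hDi)
  obtain ⟨E, hE, hEδ, hEQ⟩ := exists_pacBayes_event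
    (Measure.pi fun _ : Fin n => jointLaw ν p π₀) (P : Measure H) hF
    (M := 1) one_pos hδ (fun h => by
      have hg : Measurable fun z : Sample X K => increment t α π₀ p (ev h z.1.1) z :=
        hinc.comp ((hev.comp (measurable_const.prodMk
          (measurable_fst.comp measurable_fst))).prodMk measurable_id)
      have hone : ∫⁻ z, ENNReal.ofReal (Real.exp (increment t α π₀ p (ev h z.1.1) z))
          ∂(jointLaw ν p π₀) ≤ ENNReal.ofReal (Real.exp 0) := by
        have hgm := (Real.measurable_exp.comp hg).ennreal_ofReal
        simp only [Function.comp_def] at hgm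
        rw [jointLaw, Measure.lintegral_compProd hgm,
          Measure.lintegral_compProd (Measurable.lintegral_kernel_prod_right' hgm)]
        refine (lintegral_mono fun x => lintegral_exp_increment_le hcost π₀ t α x (ev h x)).trans ?_
        simp
      simpa using lintegral_pi_exp_sum_le (n := n) _ hg hone)
  refine ⟨E, hE, hEδ, fun D hD Q hkl => ?_⟩
  have hint_i : ∀ i, Integrable (fun h => increment t α π₀ p (ev h (D i).1.1) (D i))
      (Q : Measure H) := fun i =>
    integrable_comp_ev hev Q _ fun b => increment t α π₀ p b (D i)
  have hmain := hEQ D hD (Q : Measure H) inferInstance hkl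
    (integrable_finsetSum _ fun i _ => hint_i i)
  rw [integral_finsetSum _ fun i _ => hint_i i] at hmain
  have hterm : ∀ i, ∫ h, increment t α π₀ p (ev h (D i).1.1) (D i) ∂(Q : Measure H)
      = t * ((D i).2 * (prob (policy ev hev Q) (D i).1.2 (D i).1.1
              / prob π₀ (D i).1.2 (D i).1.1 ^ α)
            - ∫ a, smoothedMean α π₀ p (D i).1.1 a ∂(policy ev hev Q (D i).1.1))
        - t ^ 2 / 2 * ((∫ a, prob (policy ev hev Q) a (D i).1.1
                / prob π₀ a (D i).1.1 ^ (2 * α) ∂(π₀ (D i).1.1))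
            + prob (policy ev hev Q) (D i).1.2 (D i).1.1 * (D i).2 ^ 2
                / prob π₀ (D i).1.2 (D i).1.1 ^ (2 * α)) := fun i => by
    obtain ⟨⟨x, a⟩, c⟩ := D i
    simp only
    rw [← integral_policy hev Q x fun b => increment t α π₀ p b ((x, a), c)]
    simp only [increment]
    rw [integral_sub .of_finite .of_finite, integral_const_mul, integral_const_mul,
      integral_sub .of_finite .of_finite, integral_add .of_finite .of_finite]
    have e1 : ∫ b, c * weight α π₀ x b a ∂(policy ev hev Q x)
        = c * (prob (policy ev hev Q) a x / prob π₀ a x ^ α) := by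
      rw [integral_eq_sum_prob, Finset.sum_eq_single a]
      · simp only [weight, if_true]; ring
      · intro b _ hb; simp [weight, hb]
      · simp
    have e2 : ∫ b, (c * weight α π₀ x b a) ^ 2 ∂(policy ev hev Q x)
        = prob (policy ev hev Q) a x * c ^ 2 / prob π₀ a x ^ (2 * α) := by
      rw [integral_eq_sum_prob, Finset.sum_eq_single a]
      · simp only [weight, if_true]
        rw [mul_pow, inv_rpow_sq (prob_nonneg _ _ _)]; ring
      · intro b _ hb; simp [weight, hb]
      · simp
    have e3 : ∫ b, weightSq α π₀ x b ∂(policy ev hev Q x)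
        = ∫ a, prob (policy ev hev Q) a x / prob π₀ a x ^ (2 * α) ∂(π₀ x) := by
      rw [integral_eq_sum_prob, integral_eq_sum_prob]
      refine Finset.sum_congr rfl fun b _ => ?_
      rw [weightSq, inv_rpow_sq (prob_nonneg _ _ _)]; ring
    rw [e1, e2, e3]
    ring
  simp_rw [hterm] at hmain
  rw [Finset.sum_sub_distrib, ← Finset.mul_sum, ← Finset.mul_sum,
    Finset.sum_sub_distrib] at hmain
  rw [estRisk, secondMoment, ← sub_le_iff_le_add, le_div_iff₀ hn']
  refine le_of_eq_of_le ?_ hmain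
  field_simp

/-- Smoothing biases the conditional mean by at most the corresponding term of `B_n^α`. -/
theorem abs_integral_smoothedMean_sub_le (hcost : ∀ xa, p xa (Set.Icc (-1) 0) = 1)
    {α : ℝ} (hα : α ≤ 1) (π : Kernel X (Fin K)) [IsMarkovKernel π] {x : X}
    (hsupp : α = 1 → ∀ a, prob π₀ a x = 0 → prob π a x = 0) :
    |∫ a, smoothedMean α π₀ p x a ∂(π x) - ∫ a, meanCost p x a ∂(π x)|
      ≤ 1 - ∫ a, prob π₀ a x ^ (1 - α) ∂(π x) := by
  have h1 : 1 - ∫ a, prob π₀ a x ^ (1 - α) ∂(π x)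
      = ∫ a, (1 - prob π₀ a x ^ (1 - α)) ∂(π x) := by
    rw [integral_sub .of_finite .of_finite]; simp
  rw [h1, ← integral_sub .of_finite .of_finite, integral_eq_sum_prob, integral_eq_sum_prob]
  refine (Finset.abs_sum_le_sum_abs _ _).trans (Finset.sum_le_sum fun a _ => ?_)
  rw [abs_mul, abs_of_nonneg (prob_nonneg _ _ _)]
  by_cases h0 : prob π a x = 0
  · simp [h0]
  refine mul_le_mul_of_nonneg_left ?_ (prob_nonneg _ _ _)
  have hq := prob_nonneg π₀ a x
  have hm := meanCost_mem_Icc hcost x a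
  have hA : smoothedMean α π₀ p x a = prob π₀ a x ^ (1 - α) * meanCost p x a := by
    rcases hq.eq_or_lt' with hq0 | hq0
    · -- for `α = 1` the convention `0 ^ 0 = 1` would break the identity, so the support condition
      -- is needed
      have hα1 : α ≠ 1 := fun h => h0 (hsupp h a hq0)
      rw [smoothedMean, hq0, Real.zero_rpow (sub_ne_zero.2 hα1.symm)]
      simp
    · rw [smoothedMean, Real.rpow_sub hq0, Real.rpow_one]
      ring
  have hle : prob π₀ a x ^ (1 - α) ≤ 1 :=
    Real.rpow_le_one hq (prob_le_one π₀ a x) (by linarith)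
  have hfac : smoothedMean α π₀ p x a - meanCost p x a
      = (1 - prob π₀ a x ^ (1 - α)) * (-meanCost p x a) := by rw [hA]; ring
  rw [hfac, abs_mul, abs_of_nonneg (sub_nonneg.2 hle), abs_neg]
  exact mul_le_of_le_one_right (sub_nonneg.2 hle) (abs_le.2 ⟨hm.1, hm.2.trans zero_le_one⟩)

end Actions

/-! ### The uniform two-sided bound -/

section Uniform

variable {X : Type*} [MeasurableSpace X] {K : ℕ} {H : Type*} [MeasurableSpace H]

/-- The width of the confidence interval for `R(π_Q)`, as a real number. It is meaningful only
when `D_KL(Q ‖ P)` is finite. -/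
noncomputable def width (ev : H → X → Fin K) (hev : Measurable (Function.uncurry ev))
    (π₀ : Kernel X (Fin K)) (P : ProbabilityMeasure H) (α lam δ : ℝ) {n : ℕ}
    (D : Fin n → Sample X K) (Q : ProbabilityMeasure H) : ℝ :=
  √(((klDiv (Q : Measure H) (P : Measure H)).toReal + Real.log (4 * √(n : ℝ) / δ)) / (2 * n))
    + bias α π₀ (policy ev hev Q) D
    + ((klDiv (Q : Measure H) (P : Measure H)).toReal + Real.log (4 / δ)) / (n * lam)
    + lam / 2 * secondMoment α π₀ (policy ev hev Q) D

variable {ev : H → X → Fin K} (hev : Measurable (Function.uncurry ev))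
  {p : Kernel (X × Fin K) ℝ} [IsMarkovKernel p]
  (ν : Measure X) [IsProbabilityMeasure ν] (π₀ : Kernel X (Fin K)) [IsMarkovKernel π₀]

/-- The risk of every posterior lies within `width` of its smoothed estimate, outside an event of
probability at most `δ`. The context fluctuation receives the failure probability `δ / 2`, and each of the two signs
`t = λ`, `t = -λ` of the action fluctuation receives `δ / 4`. -/
theorem exists_event_abs_risk_sub_estRisk_le (hcost : ∀ xa, p xa (Set.Icc (-1) 0) = 1)
    (P : ProbabilityMeasure H) {n : ℕ} (hn : 1 ≤ n)
    {lam : ℝ} (hlam : 0 < lam) {δ : ℝ} (hδ : 0 < δ) {α : ℝ} (hα : α ≤ 1)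
    (hsupp : α = 1 → ∀ᵐ x ∂ν, ∀ a, prob π₀ a x = 0 → prob (policy ev hev P) a x = 0) :
    ∃ E : Set (Fin n → Sample X K), MeasurableSet E ∧
      (Measure.pi fun _ : Fin n => jointLaw ν p π₀) Eᶜ ≤ ENNReal.ofReal δ ∧
      ∀ D ∈ E, ∀ Q : ProbabilityMeasure H, klDiv (Q : Measure H) (P : Measure H) ≠ ∞ →
        |risk ν p (policy ev hev Q) - estRisk α π₀ (policy ev hev Q) D|
          ≤ width ev hev π₀ P α lam δ D Q := by
  have hn' : (0 : ℝ) < n := by exact_mod_cast hn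
  obtain ⟨E₁, hE₁, hE₁δ, h₁⟩ :=
    exists_event_context_deviation hev hcost ν π₀ P hn (half_pos hδ)
  obtain ⟨E₂, hE₂, hE₂δ, h₂⟩ :=
    exists_event_action_deviation hev hcost ν π₀ P hn (δ := δ / 4) (by positivity) lam α
  obtain ⟨E₃, hE₃, hE₃δ, h₃⟩ :=
    exists_event_action_deviation hev hcost ν π₀ P hn (δ := δ / 4) (by positivity) (-lam) α
  have hae : ∀ᵐ D ∂(Measure.pi fun _ : Fin n => jointLaw ν p π₀), ∀ i, α = 1 →
      ∀ a, prob π₀ a (D i).1.1 = 0 → prob (policy ev hev P) a (D i).1.1 = 0 := by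
    rw [ae_all_iff]
    intro i
    by_cases h : α = 1
    · have hq := ((measurePreserving_context (p := p) ν π₀).comp
        (measurePreserving_eval (fun _ : Fin n => jointLaw ν p π₀) i)).quasiMeasurePreserving
      filter_upwards [hq.ae (hsupp h)] with D hD _ using hD
    · exact .of_forall fun D h' => absurd h' h
  -- the support condition at the observed contexts is imposed through a measurable null superset
  obtain ⟨N, hN, hNm, hN0⟩ := exists_measurable_superset_of_null (ae_iff.1 hae)
  refine ⟨E₁ ∩ E₂ ∩ E₃ ∩ Nᶜ, ((hE₁.inter hE₂).inter hE₃).inter hNm.compl, ?_, ?_⟩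
  · rw [Set.compl_inter, Set.compl_inter, Set.compl_inter, compl_compl]
    calc _ ≤ ENNReal.ofReal (δ / 2) + ENNReal.ofReal (δ / 4) + ENNReal.ofReal (δ / 4) + 0 := by
          refine (measure_union_le _ _).trans (add_le_add ?_ hN0.le)
          refine (measure_union_le _ _).trans (add_le_add ?_ hE₃δ)
          exact (measure_union_le _ _).trans (add_le_add hE₁δ hE₂δ)
      _ = ENNReal.ofReal δ := by
          rw [add_zero, ← ENNReal.ofReal_add (by positivity) (by positivity),
            ← ENNReal.ofReal_add (by positivity) (by positivity)]
          congr 1; ring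
  · rintro D ⟨⟨⟨hD₁, hD₂⟩, hD₃⟩, hDN⟩ Q hkl
    have hDs : ∀ i, α = 1 →
        ∀ a, prob π₀ a (D i).1.1 = 0 → prob (policy ev hev P) a (D i).1.1 = 0 := by
      by_contra hcon
      exact hDN (hN hcon)
    have hac := (klDiv_ne_top_iff.1 hkl).1
    have b₁ := h₁ D hD₁ Q hkl
    have b₂ := h₂ D hD₂ Q hkl
    have b₃ := h₃ D hD₃ Q hkl
    set κ := (klDiv (Q : Measure H) (P : Measure H)).toReal
    set S := secondMoment α π₀ (policy ev hev Q) D with hS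
    set R := risk ν p (policy ev hev Q)
    set Rhat := estRisk α π₀ (policy ev hev Q) D
    set M := (1 / (n : ℝ)) * ∑ i, ∫ a, meanCost p (D i).1.1 a ∂(policy ev hev Q (D i).1.1)
      with hM
    set A := (1 / (n : ℝ)) * ∑ i, ∫ a, smoothedMean α π₀ p (D i).1.1 a
      ∂(policy ev hev Q (D i).1.1) with hA
    have b₄ : |A - M| ≤ bias α π₀ (policy ev hev Q) D := by
      have hone : bias α π₀ (policy ev hev Q) D = (1 / (n : ℝ)) * ∑ i : Fin n,
          (1 - ∫ a, prob π₀ a (D i).1.1 ^ (1 - α) ∂(policy ev hev Q (D i).1.1)) := by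
        rw [bias, Finset.sum_sub_distrib, mul_sub]
        simp [hn'.ne']
      rw [hone, hA, hM, ← mul_sub, ← Finset.sum_sub_distrib, abs_mul,
        abs_of_nonneg (by positivity : 0 ≤ 1 / (n : ℝ))]
      refine mul_le_mul_of_nonneg_left ((Finset.abs_sum_le_sum_abs _ _).trans
        (Finset.sum_le_sum fun i _ => ?_)) (by positivity)
      exact abs_integral_smoothedMean_sub_le π₀ hcost hα _ fun h a h0 =>
        prob_policy_eq_zero_of_ac hev Q hac (hDs i h a h0)
    have e1 : 2 * √(n : ℝ) / (δ / 2) = 4 * √(n : ℝ) / δ := by field_simp; norm_num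
    have e2 : 1 / (δ / 4) = 4 / δ := by field_simp
    rw [e1] at b₁
    rw [e2] at b₂ b₃
    -- dividing the bounds for `t = λ` and `t = -λ` by `λ` gives the two sides
    have b₅ : |Rhat - A| ≤ (κ + Real.log (4 / δ)) / (n * lam) + lam / 2 * S := by
      have e3 : (κ + Real.log (4 / δ)) / n = lam * ((κ + Real.log (4 / δ)) / (n * lam)) := by
        field_simp
      rw [e3] at b₂ b₃
      rw [abs_le]
      constructor
      · refine le_of_mul_le_mul_left ?_ hlam
        linarith
      · refine le_of_mul_le_mul_left ?_ hlam
        linarith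
    rw [width]
    rw [abs_le] at b₁ b₄ b₅ ⊢
    constructor <;> linarith

end Uniform

/-! ### Extended-real bookkeeping -/

section Extended

variable {X : Type*} [MeasurableSpace X] {K : ℕ} {H : Type*} [MeasurableSpace H]
  (ev : H → X → Fin K) (hev : Measurable (Function.uncurry ev)) (π₀ : Kernel X (Fin K))
  (P Q : ProbabilityMeasure H) {n : ℕ} (D : Fin n → Sample X K) {α lam δ : ℝ}

theorem kl₁_eq_ofReal (hn : 1 ≤ n) (hδ : 0 < δ) (hδ1 : δ ≤ 1)
    (hkl : klDiv (Q : Measure H) (P : Measure H) ≠ ∞) :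
    0 ≤ (klDiv (Q : Measure H) (P : Measure H)).toReal + Real.log (4 * √(n : ℝ) / δ) ∧
    kl₁ n δ P Q = ENNReal.ofReal
      ((klDiv (Q : Measure H) (P : Measure H)).toReal + Real.log (4 * √(n : ℝ) / δ)) := by
  have h1 : 1 ≤ √(n : ℝ) := by rw [Real.one_le_sqrt]; exact_mod_cast hn
  have hlog : 0 ≤ Real.log (4 * √(n : ℝ) / δ) := by
    refine Real.log_nonneg ?_
    rw [le_div_iff₀ hδ]; linarith
  refine ⟨add_nonneg ENNReal.toReal_nonneg hlog, ?_⟩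
  rw [kl₁, ENNReal.ofReal_add ENNReal.toReal_nonneg hlog, ENNReal.ofReal_toReal hkl]

theorem kl₂_eq_ofReal (hδ : 0 < δ) (hδ1 : δ ≤ 1)
    (hkl : klDiv (Q : Measure H) (P : Measure H) ≠ ∞) :
    0 ≤ (klDiv (Q : Measure H) (P : Measure H)).toReal + Real.log (4 / δ) ∧
    kl₂ δ P Q = ENNReal.ofReal
      ((klDiv (Q : Measure H) (P : Measure H)).toReal + Real.log (4 / δ)) := by
  have hlog : 0 ≤ Real.log (4 / δ) := by
    refine Real.log_nonneg ?_
    rw [le_div_iff₀ hδ]; linarith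
  refine ⟨add_nonneg ENNReal.toReal_nonneg hlog, ?_⟩
  rw [kl₂, ENNReal.ofReal_add ENNReal.toReal_nonneg hlog, ENNReal.ofReal_toReal hkl]

theorem sqrt_kl₁_eq_ofReal (hn : 1 ≤ n) (hδ : 0 < δ) (hδ1 : δ ≤ 1)
    (hkl : klDiv (Q : Measure H) (P : Measure H) ≠ ∞) :
    (kl₁ n δ P Q / (2 * (n : ℝ≥0∞))) ^ (1 / 2 : ℝ) = ENNReal.ofReal
      √(((klDiv (Q : Measure H) (P : Measure H)).toReal + Real.log (4 * √(n : ℝ) / δ))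
        / (2 * n)) := by
  have hn' : (0 : ℝ) < n := by exact_mod_cast hn
  obtain ⟨h0, h1⟩ := kl₁_eq_ofReal P Q hn hδ hδ1 hkl
  have h2 : (2 * (n : ℝ≥0∞)) = ENNReal.ofReal (2 * n) := by
    rw [ENNReal.ofReal_mul (by norm_num), ENNReal.ofReal_natCast]; simp
  rw [h1, h2, ← ENNReal.ofReal_div_of_pos (by positivity),
    ENNReal.ofReal_rpow_of_nonneg (by positivity) (by norm_num), ← Real.sqrt_eq_rpow]

theorem kl₂_div_eq_ofReal (hn : 1 ≤ n) (hlam : 0 < lam) (hδ : 0 < δ) (hδ1 : δ ≤ 1)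
    (hkl : klDiv (Q : Measure H) (P : Measure H) ≠ ∞) :
    kl₂ δ P Q / ENNReal.ofReal ((n : ℝ) * lam) = ENNReal.ofReal
      (((klDiv (Q : Measure H) (P : Measure H)).toReal + Real.log (4 / δ)) / (n * lam)) := by
  have hn' : (0 : ℝ) < n := by exact_mod_cast hn
  rw [(kl₂_eq_ofReal P Q hδ hδ1 hkl).2, ← ENNReal.ofReal_div_of_pos (by positivity)]

theorem objective_eq_coe (hn : 1 ≤ n) (hlam : 0 < lam) (hδ : 0 < δ) (hδ1 : δ ≤ 1)
    (hkl : klDiv (Q : Measure H) (P : Measure H) ≠ ∞) :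
    objective ev hev π₀ P α lam δ D Q
      = ((estRisk α π₀ (policy ev hev Q) D + width ev hev π₀ P α lam δ D Q : ℝ) : EReal) := by
  have hn' : (0 : ℝ) < n := by exact_mod_cast hn
  have h2 := (kl₂_eq_ofReal P Q hδ hδ1 hkl).1
  rw [objective, sqrt_kl₁_eq_ofReal P Q hn hδ hδ1 hkl, kl₂_div_eq_ofReal P Q hn hlam hδ hδ1 hkl,
    EReal.coe_ennreal_ofReal, EReal.coe_ennreal_ofReal, max_eq_left (Real.sqrt_nonneg _),
    max_eq_left (by positivity), width]
  norm_cast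
  ring

theorem oracle_bound_eq_coe (r : ℝ) (hn : 1 ≤ n) (hlam : 0 < lam) (hδ : 0 < δ) (hδ1 : δ ≤ 1)
    (hkl : klDiv (Q : Measure H) (P : Measure H) ≠ ∞) :
    (r : EReal) + (2 * (kl₁ n δ P Q / (2 * (n : ℝ≥0∞))) ^ (1 / 2 : ℝ) : ℝ≥0∞)
        + ((2 * bias α π₀ (policy ev hev Q) D : ℝ) : EReal)
        + (2 * kl₂ δ P Q / ENNReal.ofReal ((n : ℝ) * lam) : ℝ≥0∞)
        + ((lam * secondMoment α π₀ (policy ev hev Q) D : ℝ) : EReal)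
      = ((r + 2 * width ev hev π₀ P α lam δ D Q : ℝ) : EReal) := by
  have hn' : (0 : ℝ) < n := by exact_mod_cast hn
  have h2 := (kl₂_eq_ofReal P Q hδ hδ1 hkl).1
  have htwo : (2 : ℝ≥0∞) = ENNReal.ofReal 2 := by simp
  rw [mul_div_assoc, sqrt_kl₁_eq_ofReal P Q hn hδ hδ1 hkl,
    kl₂_div_eq_ofReal P Q hn hlam hδ hδ1 hkl, htwo, ← ENNReal.ofReal_mul (by norm_num),
    ← ENNReal.ofReal_mul (by norm_num), EReal.coe_ennreal_ofReal, EReal.coe_ennreal_ofReal,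
    max_eq_left (by positivity), max_eq_left (by positivity), width]
  norm_cast
  ring

theorem oracle_bound_eq_top (r : ℝ) (hkl : klDiv (Q : Measure H) (P : Measure H) = ∞) :
    (r : EReal) + (2 * (kl₁ n δ P Q / (2 * (n : ℝ≥0∞))) ^ (1 / 2 : ℝ) : ℝ≥0∞)
        + ((2 * bias α π₀ (policy ev hev Q) D : ℝ) : EReal)
        + (2 * kl₂ δ P Q / ENNReal.ofReal ((n : ℝ) * lam) : ℝ≥0∞)
        + ((lam * secondMoment α π₀ (policy ev hev Q) D : ℝ) : EReal) = ⊤ := by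
  have h1 : kl₁ n δ P Q = ∞ := by simp [kl₁, hkl]
  have h2 : kl₂ δ P Q = ∞ := by simp [kl₂, hkl]
  have h3 : (2 * (n : ℝ≥0∞)) ≠ ∞ := ENNReal.mul_ne_top (by simp) (by simp)
  rw [h1, h2, ENNReal.top_div_of_ne_top h3, ENNReal.top_rpow_of_pos (by norm_num),
    ENNReal.mul_top (by simp), ENNReal.top_div_of_ne_top ENNReal.ofReal_ne_top,
    EReal.coe_ennreal_top, EReal.coe_add_top, EReal.top_add_coe, EReal.top_add_top,
    EReal.top_add_coe]

theorem objective_eq_top (hkl : klDiv (Q : Measure H) (P : Measure H) = ∞) :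
    objective ev hev π₀ P α lam δ D Q = ⊤ := by
  have h1 : kl₁ n δ P Q = ∞ := by simp [kl₁, hkl]
  have h2 : kl₂ δ P Q = ∞ := by simp [kl₂, hkl]
  have h3 : (2 * (n : ℝ≥0∞)) ≠ ∞ := ENNReal.mul_ne_top (by simp) (by simp)
  rw [objective, h1, h2, ENNReal.top_div_of_ne_top h3, ENNReal.top_rpow_of_pos (by norm_num),
    ENNReal.top_div_of_ne_top ENNReal.ofReal_ne_top, EReal.coe_ennreal_top,
    EReal.coe_add_top, EReal.top_add_coe, EReal.top_add_top, EReal.top_add_coe]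

end Extended

end OffPolicy

theorem mainTheorem3
    {X : Type*} [MeasurableSpace X] {K : ℕ} {H : Type*} [MeasurableSpace H]
    (ν : Measure X) [IsProbabilityMeasure ν]
    (p : Kernel (X × Fin K) ℝ) [IsMarkovKernel p]
    (hcost : ∀ xa, p xa (Set.Icc (-1) 0) = 1)
    (π₀ : Kernel X (Fin K)) [IsMarkovKernel π₀]
    (ev : H → X → Fin K) (hev : Measurable (Function.uncurry ev))
    (P : ProbabilityMeasure H)
    (n : ℕ) (hn : 1 ≤ n) (lam : ℝ) (hlam : 0 < lam)
    (δ : ℝ) (hδ : 0 < δ) (hδ1 : δ ≤ 1) (α : ℝ) (hα : α ∈ Set.Icc (0 : ℝ) 1)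
    (hsupp : α = 1 → ∀ᵐ x ∂ν, ∀ a, OffPolicy.prob π₀ a x = 0 →
      OffPolicy.prob (OffPolicy.policy ev hev P) a x = 0) :
    ∃ E : Set (Fin n → OffPolicy.Sample X K), MeasurableSet E ∧
      ENNReal.ofReal (1 - δ) ≤
        Measure.pi (fun _ : Fin n => OffPolicy.jointLaw ν p π₀) E ∧
      ∀ D ∈ E, ∀ Qhat Qstar : ProbabilityMeasure H,
        IsMinOn (OffPolicy.objective ev hev π₀ P α lam δ D) Set.univ Qhat →
        IsMinOn (fun Q => OffPolicy.risk ν p (OffPolicy.policy ev hev Q)) Set.univ Qstar →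
        (OffPolicy.risk ν p (OffPolicy.policy ev hev Qhat) : EReal) ≤
          (OffPolicy.risk ν p (OffPolicy.policy ev hev Qstar) : EReal)
          + (2 * (OffPolicy.kl₁ n δ P Qstar / (2 * (n : ℝ≥0∞))) ^ (1 / 2 : ℝ) : ℝ≥0∞)
          + ((2 * OffPolicy.bias α π₀ (OffPolicy.policy ev hev Qstar) D : ℝ) : EReal)
          + (2 * OffPolicy.kl₂ δ P Qstar / ENNReal.ofReal ((n : ℝ) * lam) : ℝ≥0∞)
          + ((lam * OffPolicy.secondMoment α π₀ (OffPolicy.policy ev hev Qstar) D : ℝ) :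
              EReal) := by
  obtain ⟨E, hE, hEδ, hEQ⟩ := OffPolicy.exists_event_abs_risk_sub_estRisk_le hev ν π₀ hcost P hn
    hlam hδ hα.2 hsupp
  refine ⟨E, hE, ?_, fun D hD Qhat Qstar hQhat _ => ?_⟩
  · rw [ENNReal.ofReal_sub _ hδ.le, ENNReal.ofReal_one, tsub_le_iff_right]
    calc (1 : ℝ≥0∞) = Measure.pi (fun _ : Fin n => OffPolicy.jointLaw ν p π₀) Set.univ := by simp
      _ ≤ _ := by
        rw [← Set.union_compl_self E]
        exact (measure_union_le _ _).trans (add_le_add le_rfl hEδ)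
  · by_cases hstar : klDiv (Qstar : Measure H) (P : Measure H) = ∞
    · rw [OffPolicy.oracle_bound_eq_top ev hev π₀ P Qstar D _ hstar]
      exact le_top
    have hle : OffPolicy.objective ev hev π₀ P α lam δ D Qhat
        ≤ OffPolicy.objective ev hev π₀ P α lam δ D Qstar := hQhat (Set.mem_univ _)
    rw [OffPolicy.objective_eq_coe ev hev π₀ P Qstar D hn hlam hδ hδ1 hstar] at hle
    have hhat : klDiv (Qhat : Measure H) (P : Measure H) ≠ ∞ := by
      intro htop
      rw [OffPolicy.objective_eq_top ev hev π₀ P Qhat D htop, top_le_iff] at hle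
      exact EReal.coe_ne_top _ hle
    rw [OffPolicy.objective_eq_coe ev hev π₀ P Qhat D hn hlam hδ hδ1 hhat,
      EReal.coe_le_coe_iff] at hle
    rw [OffPolicy.oracle_bound_eq_coe ev hev π₀ P Qstar D _ hn hlam hδ hδ1 hstar,
      EReal.coe_le_coe_iff]
    have h1 := (abs_le.1 (hEQ D hD Qhat hhat)).2
    have h2 := (abs_le.1 (hEQ D hD Qstar hstar)).1
    linarith
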